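/- Let $n\ge 1$ and let $W$ be the Weyl group of type $B_n$, acting on $\mathfrak h^*=\mathbb K^n$ ($\mathbb K$ a field of characteristic $0$, e.g. $\mathbb C$ or $\mathbb R$) with standard basis $\varepsilon_1,\dots,\varepsilon_n$, generated by the reflections $s_1,\dots,s_n$ in the simple roots $\alpha_i=\varepsilon_i-\varepsilon_{i+1}$ ($i<n$) and $\alpha_n=\varepsilon_n$. Let $w=s_n(s_{n-1}s_n)\cdots(s_1s_2\cdots s_n)$ with this fixed reduced word $s_{i_1}\cdots s_{i_t}$, $t=n(n+1)/2$; its letters fill, row by row from the top and from left to right, the staircase tableau whose $r$-th row has $r$ boxes. A diagram $\Delta$ is a set of boxes (the black ones), identified with a subset of $\{1,\dots,t\}$. Put $s_{i_k}^\Delta=s_{i_k}$ if $k\in\Delta$ and $s_{i_k}^\Delta=\mathrm{id}$ otherwise, $w^\Delta=s_{i_1}^\Delta\cdots s_{i_t}^\Delta$ and $v_\ell^\Delta=s_{i_t}^\Delta\cdots s_{i_{t-\ell+1}}^\Delta$. The diagram $\Delta$ is Cauchon if $v_{\ell-1}^\Delta<v_{\ell-1}^\Delta s_{i_{t-\ell+1}}$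 in the Bruhat order for all $1\le\ell\le t$. Given $\Delta$, colour the $n\times n$ grid so that its lower triangular part (with the diagonal) is $\Delta$ and its upper triangular part is the reflection of $\Delta$ in the diagonal. Label the rows $1,\dots,n$ from the bottom and the columns $-n,\dots,-1$ from the left. Let $\tau_\Delta$ be the permutation of $[n]\cup(-[n])$ that sends $i$ (on the right or bottom side) to the label on the left or top side that is reached by the pipe starting at $i$, where a pipe goes straight across each black square, and in each white square a pipe entering from the right turns upwards and a pipe entering from below turns to the left. In what follows $R_1,R_2,\dots$ are nonempty, increasing, pairwise disjoint sequences in $[n]$, and $-R$ is obtained from $R$ by negating the entries. For $m\ge1$, a type (b) cycle pair of $\tau_\Delta$ is an unordered pair of cycles of $\tau_\Delta$ of the form $(R_1,-R_2,R_3,\dots,-R_{2m})$, $(-R_1,R_2,-R_3,\dots,R_{2m})$; a type (c) cycle is a cycle of the form $(R_1,-R_2,\dots,R_{2m-1},-R_1,R_2,\dots,-R_{2m-1})$. Each is called even or odd according to the parity of $\sum_i|R_i|$. **Theorem.** Let $\Delta$ be a Cauchon diagram. Then $\dim\ker(w^\Delta+w)$ equals the number of even type (b) cycle pairs plus the number of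 odd type (c) cycles of $\tau=\tau_\Delta$. Moreover, for each even type (b) pair and each odd type (c) cycle $C$, fix any way of writing it with sequences $R_1,R_2,\dots$ as above, let $a$ be the first entry of $R_1$, let $r=\sum_i|R_i|$, and define $v_C\in\mathbb K^n$ by $$(v_C)_{|\tau^j(a)|}=(-1)^j\prod_{\ell=1}^{j}P\bigl[|\tau^{\ell-1}(a)|,|\tau^{\ell}(a)|\bigr]\qquad(0\le j<r),$$ all other components being $0$, where $P[i,k]=1$ if $\tau(i)=k$, $P[i,k]=-1$ if $\tau(i)=-k$, and $P[i,k]=0$ otherwise. Then the vectors $w^{-1}v_C$, indexed by these $C$, form a basis of $\ker(w^\Delta+w)$. -/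

import Mathlib

namespace TypeB

/-! ### The Weyl group of type `B_n` acting on the dual of the Cartan subalgebra

The space is `𝕜^n` with its standard basis `ε_1, …, ε_n`. The index `k : Fin n` stands for the
number `k + 1` of `{1, …, n}`. -/

section Weyl

variable (𝕜 : Type*) [Field 𝕜] {n : ℕ}

/-- `α_i = ε_i - ε_{i+1}` for `i < n`, and `α_n = ε_n` is the short simple root. -/
def simpleRoot (i : Fin n) : Fin n → 𝕜 :=
  if h : (i : ℕ) + 1 < n then Pi.single i 1 - Pi.single ⟨(i : ℕ) + 1, h⟩ 1 else Pi.single i 1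

/-- The coroot of `α_i`, that is, the functional `x ↦ 2 (x, α_i) / (α_i, α_i)`. -/
def simpleCoroot (i : Fin n) : Module.Dual 𝕜 (Fin n → 𝕜) :=
  if h : (i : ℕ) + 1 < n then LinearMap.proj i - LinearMap.proj ⟨(i : ℕ) + 1, h⟩
  else (2 : 𝕜) • LinearMap.proj i

theorem simpleCoroot_simpleRoot (i : Fin n) : simpleCoroot 𝕜 i (simpleRoot 𝕜 i) = 2 := by
  unfold simpleCoroot simpleRoot
  split_ifs with h
  · have h1 : i ≠ ⟨(i : ℕ) + 1, h⟩ := by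
      intro h2
      have := congrArg Fin.val h2
      simp at this
    simp [h1, h1.symm]
    norm_num
  · simp

/-- The simple reflection `s_i`, `x ↦ x - ⟨x, α_i^∨⟩ α_i`. -/
noncomputable def simpleReflection (i : Fin n) : (Fin n → 𝕜) ≃ₗ[𝕜] (Fin n → 𝕜) :=
  Module.reflection (simpleCoroot_simpleRoot 𝕜 i)

/-- The Weyl group `W`. -/
def weylGroup (n : ℕ) : Subgroup ((Fin n → 𝕜) ≃ₗ[𝕜] (Fin n → 𝕜)) :=
  Subgroup.closure (Set.range (simpleReflection 𝕜))

/-- The length of an element of the Weyl group. -/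
noncomputable def length (g : (Fin n → 𝕜) ≃ₗ[𝕜] (Fin n → 𝕜)) : ℕ :=
  sInf {l | ∃ L : List (Fin n), L.length = l ∧ (L.map (simpleReflection 𝕜)).prod = g}

/-- The reflections of the Weyl group: the conjugates of the simple reflections. -/
def IsWeylReflection (t : (Fin n → 𝕜) ≃ₗ[𝕜] (Fin n → 𝕜)) : Prop :=
  ∃ g ∈ weylGroup 𝕜 n, ∃ i : Fin n, t = g * simpleReflection 𝕜 i * g⁻¹

/-- The strict Bruhat order on `W`: the transitive closure of the relation `u < u t`, where
`u ∈ W`, `t` is a reflection of `W` and `ℓ(u) < ℓ(u t)`. -/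
def BruhatLT : ((Fin n → 𝕜) ≃ₗ[𝕜] (Fin n → 𝕜)) → ((Fin n → 𝕜) ≃ₗ[𝕜] (Fin n → 𝕜)) → Prop :=
  Relation.TransGen fun u v =>
    u ∈ weylGroup 𝕜 n ∧ ∃ t, IsWeylReflection 𝕜 t ∧ v = u * t ∧ length 𝕜 u < length 𝕜 v

end Weyl

/-! ### The Young tableau and Cauchon diagrams -/

/-- The boxes of the staircase tableau: the row `r` has the columns `0, …, r`. Rows are counted
from the top and columns from the left, both from `0`. -/
abbrev Box (n : ℕ) : Type := Σ r : Fin n, Fin ((r : ℕ) + 1)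

/-- All boxes in reading order: rows from top to bottom, each from left to right. -/
def boxes (n : ℕ) : List (Box n) :=
  (List.finRange n).flatMap fun r : Fin n =>
    (List.finRange ((r : ℕ) + 1)).map fun c => (⟨r, c⟩ : Box n)

/-- The index of the simple reflection in a box: the first row holds `s_n`, the second
`s_{n-1}, s_n`, and so on, and the last one `s_1, …, s_n`. -/
def boxIndex {n : ℕ} (b : Box n) : Fin n :=
  ⟨n - 1 - (b.1 : ℕ) + (b.2 : ℕ), by have h1 := b.1.isLt; have h2 := b.2.isLt; omega⟩

section Diagram

variable (𝕜 : Type*) [Field 𝕜] {n : ℕ}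

/-- `w = s_n (s_{n-1} s_n) ⋯ (s_1 s_2 ⋯ s_n)`. -/
noncomputable def maxElt (n : ℕ) : (Fin n → 𝕜) ≃ₗ[𝕜] (Fin n → 𝕜) :=
  ((boxes n).map fun b => simpleReflection 𝕜 (boxIndex b)).prod

/-- The reflection of the box if the box is in `Δ`, and the identity otherwise. -/
noncomputable def subReflection (Δ : Finset (Box n)) (b : Box n) :
    (Fin n → 𝕜) ≃ₗ[𝕜] (Fin n → 𝕜) :=
  if b ∈ Δ then simpleReflection 𝕜 (boxIndex b) else 1

/-- `w^Δ`, the product of the reflections of the black boxes in reading order. -/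
noncomputable def subElt (Δ : Finset (Box n)) : (Fin n → 𝕜) ≃ₗ[𝕜] (Fin n → 𝕜) :=
  ((boxes n).map (subReflection 𝕜 Δ)).prod

/-- `v_ℓ^Δ`, the product over the last `ℓ` boxes, in the reverse of the reading order. -/
noncomputable def revSubElt (Δ : Finset (Box n)) (l : ℕ) : (Fin n → 𝕜) ≃ₗ[𝕜] (Fin n → 𝕜) :=
  (((boxes n).reverse.take l).map (subReflection 𝕜 Δ)).prod

/-- The diagram `Δ` (the set of the black boxes) is Cauchon: `v_ℓ^Δ < v_ℓ^Δ s` in the Bruhat order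
for `0 ≤ ℓ < n(n+1)/2`, where `s` is the simple reflection of the box that has exactly `ℓ` boxes
after it in reading order. -/
def IsCauchon (Δ : Finset (Box n)) : Prop :=
  ∀ (l : ℕ) (hl : l < (boxes n).reverse.length),
    BruhatLT 𝕜 (revSubElt 𝕜 Δ l)
      (revSubElt 𝕜 Δ l * simpleReflection 𝕜 (boxIndex ((boxes n).reverse[l])))

end Diagram

/-! ### Pipe dreams -/

/-- The set `[n] ∪ -[n]`: the pair `(ε, k)` stands for `ε (k + 1)`. -/
abbrev SignedIndex (n : ℕ) : Type := ℤˣ × Fin n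

/-- The square in row `r` (from the top) and column `c` (from the left), counted from `0`, of the
`n × n` grid is black in the symmetric diagram of `Δ`: the lower triangular part is `Δ`, and the
upper triangular part is its reflection. -/
def IsBlack {n : ℕ} (Δ : Finset (Box n)) (r c : ℕ) : Prop :=
  ∃ b ∈ Δ, ((b.1 : ℕ) = r ∧ (b.2 : ℕ) = c) ∨ ((b.1 : ℕ) = c ∧ (b.2 : ℕ) = r)

instance {n : ℕ} (Δ : Finset (Box n)) (r c : ℕ) : Decidable (IsBlack Δ r c) := by
  unfold IsBlack; infer_instance

inductive Heading
  | left
  | up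

/-- The label of a pipe that leaves the grid. Rows are labelled `1, …, n` from the bottom, and
columns `-n, …, -1` from the left. `left`: at the left end of row `r`. `up`: at the top of
column `r`. -/
def exitLabel {n : ℕ} (hn : 0 < n) (d : Heading) (r : ℕ) : SignedIndex n :=
  (match d with | .left => 1 | .up => -1, ⟨n - 1 - r, by omega⟩)

/-- Follow a pipe to the top or the left side of the grid.
`left r c`: the pipe runs to the left in row `r`, with the `c` columns `0, …, c - 1` in front of it.
`up r c`: the pipe runs upwards in column `c`, with the `r` rows `0, …, r - 1` in front of it.
A black square is crossed straight. In a white square a pipe that comes from the right turns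
upwards, and one that comes from below turns to the left. -/
def followPipe {n : ℕ} (hn : 0 < n) (Δ : Finset (Box n)) : Heading → ℕ → ℕ → SignedIndex n
  | .left, r, 0 => exitLabel hn .left r
  | .left, r, c + 1 => if IsBlack Δ r c then followPipe hn Δ .left r c else followPipe hn Δ .up r c
  | .up, 0, c => exitLabel hn .up c
  | .up, r + 1, c => if IsBlack Δ r c then followPipe hn Δ .up r c else followPipe hn Δ .left r c
termination_by _ r c => r + c

/-- The end of the pipe that starts at `i` on the right side (`i > 0`, row `i`) or on the bottom
side (`i < 0`, column `i`). -/
def pipeEnd {n : ℕ} (Δ : Finset (Box n)) (i : SignedIndex n) : SignedIndex n :=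
  if i.1 = 1 then followPipe (Fin.pos i.2) Δ .left (n - 1 - i.2) n
  else followPipe (Fin.pos i.2) Δ .up n (n - 1 - i.2)

theorem followPipe_mem_range {n : ℕ} (hn : 0 < n) (Δ : Finset (Box n)) (k : ℕ) :
    ∀ r c : ℕ, 2 * n ≤ r + c + k →
      (r < n → c ≤ n → ∃ i, pipeEnd Δ i = followPipe hn Δ .left r c) ∧
      (r ≤ n → c < n → ∃ i, pipeEnd Δ i = followPipe hn Δ .up r c) := by
  induction k with
  | zero =>
    intro r c h
    exact ⟨fun h1 h2 => by omega, fun h1 h2 => by omega⟩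
  | succ k ih =>
    intro r c h
    constructor
    · intro h1 h2
      rcases Nat.lt_or_ge c n with h3 | h3
      · by_cases hb : IsBlack Δ r c
        · obtain ⟨i, hi⟩ := (ih r (c + 1) (by omega)).1 h1 h3
          exact ⟨i, by rw [hi, followPipe, if_pos hb]⟩
        · obtain ⟨i, hi⟩ := (ih (r + 1) c (by omega)).2 h1 h3
          exact ⟨i, by rw [hi, followPipe, if_neg hb]⟩
      · obtain rfl : c = n := le_antisymm h2 h3
        refine ⟨(1, ⟨c - 1 - r, by omega⟩), ?_⟩
        have : c - 1 - (c - 1 - r) = r := by omega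
        simp [pipeEnd, this]
    · intro h1 h2
      rcases Nat.lt_or_ge r n with h3 | h3
      · by_cases hb : IsBlack Δ r c
        · obtain ⟨i, hi⟩ := (ih (r + 1) c (by omega)).2 h3 h2
          exact ⟨i, by rw [hi, followPipe, if_pos hb]⟩
        · obtain ⟨i, hi⟩ := (ih r (c + 1) (by omega)).1 h3 h2
          exact ⟨i, by rw [hi, followPipe, if_neg hb]⟩
      · obtain rfl : r = n := le_antisymm h1 h3
        refine ⟨(-1, ⟨r - 1 - c, by omega⟩), ?_⟩
        have : r - 1 - (r - 1 - c) = c := by omega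
        have h4 : (-1 : ℤˣ) ≠ 1 := by decide
        simp [pipeEnd, this, h4]

theorem pipeEnd_bijective {n : ℕ} (Δ : Finset (Box n)) : Function.Bijective (pipeEnd Δ) := by
  refine Function.Surjective.bijective_of_finite fun y => ?_
  obtain ⟨e, k⟩ := y
  have hn : 0 < n := Fin.pos k
  have hk : n - 1 - (n - 1 - (k : ℕ)) = k := by omega
  have key := followPipe_mem_range hn Δ (2 * n)
  rcases Int.units_eq_one_or e with rfl | rfl
  · obtain ⟨i, hi⟩ := (key (n - 1 - k) 0 (by omega)).1 (by omega) (by omega)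
    exact ⟨i, by rw [hi, followPipe]; simp [exitLabel, hk]⟩
  · obtain ⟨i, hi⟩ := (key 0 (n - 1 - k) (by omega)).2 (by omega) (by omega)
    exact ⟨i, by rw [hi, followPipe]; simp [exitLabel, hk]⟩

/-- The permutation `τ_Δ` of `[n] ∪ -[n]` that the pipes define. -/
noncomputable def pipePerm {n : ℕ} (Δ : Finset (Box n)) : Equiv.Perm (SignedIndex n) :=
  Equiv.ofBijective (pipeEnd Δ) (pipeEnd_bijective Δ)

/-! ### Types of cycles -/

/-- `signedWord 1 [R_1, R_2, R_3, …]` is the concatenation of `R_1, -R_2, R_3, …`, and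
`signedWord (-1) [R_1, R_2, R_3, …]` is the concatenation of `-R_1, R_2, -R_3, …`. -/
def signedWord {n : ℕ} : ℤˣ → List (List (Fin n)) → List (SignedIndex n)
  | _, [] => []
  | e, R :: Rs => R.map (fun i => (e, i)) ++ signedWord (-e) Rs

/-- `R_1, R_2, …` are nonempty, increasing and pairwise disjoint sequences. -/
def IsBlockList {n : ℕ} (Rs : List (List (Fin n))) : Prop :=
  (∀ R ∈ Rs, R ≠ [] ∧ R.Pairwise (· < ·)) ∧ Rs.flatten.Nodup

/-- `C` is the pair of cycles `(R_1, -R_2, …, -R_{2m})`, `(-R_1, R_2, …, R_{2m})` of `σ`, for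
some `m ≥ 1`. -/
def IsTypeB {n : ℕ} (σ : Equiv.Perm (SignedIndex n)) (Rs : List (List (Fin n)))
    (C : Finset (Equiv.Perm (SignedIndex n))) : Prop :=
  IsBlockList Rs ∧ (∃ m, 1 ≤ m ∧ Rs.length = 2 * m) ∧
    C = {(signedWord 1 Rs).formPerm, (signedWord (-1) Rs).formPerm} ∧ C ⊆ σ.cycleFactorsFinset

/-- `C` consists of the single cycle `(R_1, -R_2, …, R_{2m-1}, -R_1, R_2, …, -R_{2m-1})` of `σ`,
for some `m ≥ 1`. -/
def IsTypeC {n : ℕ} (σ : Equiv.Perm (SignedIndex n)) (Rs : List (List (Fin n)))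
    (C : Finset (Equiv.Perm (SignedIndex n))) : Prop :=
  IsBlockList Rs ∧ (∃ m, 1 ≤ m ∧ Rs.length = 2 * m - 1) ∧
    C = {(signedWord 1 Rs ++ signedWord (-1) Rs).formPerm} ∧ C ⊆ σ.cycleFactorsFinset

/-- The pairs of cycles of type (b) with `∑ |R_i|` even. -/
def evenTypeB {n : ℕ} (σ : Equiv.Perm (SignedIndex n)) :
    Set (Finset (Equiv.Perm (SignedIndex n))) :=
  {C | ∃ Rs, IsTypeB σ Rs C ∧ Even (Rs.map List.length).sum}

/-- The cycles of type (c) with `∑ |R_i|` odd. -/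
def oddTypeC {n : ℕ} (σ : Equiv.Perm (SignedIndex n)) :
    Set (Finset (Equiv.Perm (SignedIndex n))) :=
  {C | ∃ Rs, IsTypeC σ Rs C ∧ Odd (Rs.map List.length).sum}

section Vectors

variable (𝕜 : Type*) [Field 𝕜] {n : ℕ}

/-- The `n × n` matrix with entry `1` at `(i, j)` if `σ(i) = j`, `-1` if `σ(i) = -j`, and `0`
otherwise. -/
def signedMatrix (σ : Equiv.Perm (SignedIndex n)) : Matrix (Fin n) (Fin n) 𝕜 :=
  Matrix.of fun i j => if σ (1, i) = (1, j) then 1 else if σ (1, i) = (-1, j) then -1 else 0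

/-- The vector `v` that is attached to a cycle or a pair of cycles with the blocks `R_1, R_2, …`:
if `a` is the first entry of `R_1` and `r = ∑ |R_i|`, then for `0 ≤ j < r` the component of `v` at
`|σ^j(a)|` is `(-1)^j ∏_{l < j} P[|σ^l(a)|, |σ^{l+1}(a)|]`, with `P` the signed matrix of `σ`, and
all other components are `0`. -/
def cycleVector (σ : Equiv.Perm (SignedIndex n)) (Rs : List (List (Fin n))) : Fin n → 𝕜 :=
  match Rs.flatten with
  | [] => 0
  | a :: _ => ∑ j ∈ Finset.range (Rs.map List.length).sum,
      Pi.single ((σ ^ j) (1, a)).2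
        ((-1) ^ j * ∏ l ∈ Finset.range j,
          signedMatrix 𝕜 σ ((σ ^ l) (1, a)).2 ((σ ^ (l + 1)) (1, a)).2)

/-- `ker (w^Δ + w)`. -/
noncomputable def kernel (Δ : Finset (Box n)) : Submodule 𝕜 (Fin n → 𝕜) :=
  LinearMap.ker ((subElt 𝕜 Δ : (Fin n → 𝕜) →ₗ[𝕜] (Fin n → 𝕜)) + (maxElt 𝕜 n).toLinearMap)

end Vectors

end TypeB

/-! Write `P` for the signed matrix of `τ = τ_Δ`. If the factors of `w^Δ` are applied to `±ε_k` one
at a time, the vector runs through the grid along a pipe; for the full diagram all pipes are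
straight. Hence `w^Δ w⁻¹` maps `±ε_k` to the basis vector of the signed index `τ(±k)`, that is,
`w^Δ w⁻¹ v = v P`, and `w` maps `ker (w^Δ + w)` onto the space of the row vectors with `v P = -v`.

Such a `v` is an odd function on `[n] ∪ -[n]` that changes its sign at each step along `τ`, so it
vanishes at fixed points and is determined by one value on each orbit and its negative. The
reflection symmetry of the grid gives `τ(-x) = -τ(x)`, and a pipe that runs to the left or upwards
satisfies `|τ(x)| ≥ |x|` if `x` and `τ(x)` have the same sign. So no orbit of constant sign is
longer than a fixed point, and every other orbit, started at a change of sign, splits into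
increasing blocks `R_1, -R_2, R_3, …`: its type is (b) or (c) according to the parity of the number
of blocks. After `∑ |R_i|` steps the orbit is at `±a` with the sign given by this parity, so a
nonzero value at `a` can be continued consistently exactly if the number of blocks and `∑ |R_i|`
have the same parity, that is, for even type (b) and odd type (c). The vectors `v_C` arise from the
value `1` at `a`, and have disjoint supports: the values at the points `a` are the dual basis. -/

namespace TypeB

section SignedIndices

variable {n : ℕ} {σ : Equiv.Perm (SignedIndex n)}

/-- The action of the signs `±1` on `[n] ∪ -[n]`. -/
def signMul (e : ℤˣ) (x : SignedIndex n) : SignedIndex n :=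
  (e * x.1, x.2)

theorem signMul_signMul (e e' : ℤˣ) (x : SignedIndex n) :
    signMul e (signMul e' x) = signMul (e * e') x := by
  simp only [signMul, mul_assoc]

theorem eq_signMul_of_snd_eq {x y : SignedIndex n} (h : x.2 = y.2) :
    x = signMul (x.1 * y.1) y := by
  rw [signMul, mul_assoc, Int.units_mul_self, mul_one, ← h]

/-- `σ` commutes with the signs: it is a signed permutation of `[n]`. -/
def IsSigned (σ : Equiv.Perm (SignedIndex n)) : Prop :=
  ∀ (e : ℤˣ) (x : SignedIndex n), σ (signMul e x) = signMul e (σ x)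

/-- The map `k ↦ |σ(k)|` on `[n]`. -/
def absMap (σ : Equiv.Perm (SignedIndex n)) (k : Fin n) : Fin n :=
  (σ (1, k)).2

theorem IsSigned.pow (hσ : IsSigned σ) (j : ℕ) : IsSigned (σ ^ j) := by
  induction j with
  | zero => exact fun e x => rfl
  | succ j ih =>
    intro e x
    rw [pow_succ', Equiv.Perm.mul_apply, Equiv.Perm.mul_apply, ih, hσ]

theorem IsSigned.apply_mk (hσ : IsSigned σ) (e : ℤˣ) (k : Fin n) :
    σ (e, k) = signMul e (σ (1, k)) := by
  rw [← hσ, signMul, mul_one]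

theorem IsSigned.snd_apply (hσ : IsSigned σ) (x : SignedIndex n) :
    (σ x).2 = absMap σ x.2 := by
  rw [← Prod.mk.eta (p := x), hσ.apply_mk]
  rfl

theorem IsSigned.snd_pow_apply (hσ : IsSigned σ) (j : ℕ) (x : SignedIndex n) :
    ((σ ^ j) x).2 = (absMap σ)^[j] x.2 := by
  rw [← Equiv.Perm.iterate_eq_pow]
  exact Function.Semiconj.iterate_right (f := Prod.snd) hσ.snd_apply j x

theorem IsSigned.absMap_injective (hσ : IsSigned σ) : Function.Injective (absMap σ) := by
  intro k l hkl
  have h := eq_signMul_of_snd_eq (x := σ (1, k)) (y := σ (1, l)) hkl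
  rw [← hσ] at h
  exact congrArg Prod.snd (σ.injective h)

theorem IsSigned.pow_apply_signMul_eq (hσ : IsSigned σ) {x : SignedIndex n} {e : ℤˣ} {r : ℕ}
    (h : (σ ^ r) x = signMul e x) (e' : ℤˣ) (j : ℕ) :
    (σ ^ r) (signMul e' ((σ ^ j) x)) = signMul e (signMul e' ((σ ^ j) x)) := by
  rw [hσ.pow, ← Equiv.Perm.mul_apply, ← pow_add, add_comm, pow_add, Equiv.Perm.mul_apply, h,
    hσ.pow, signMul_signMul, signMul_signMul, mul_comm]

end SignedIndices

section SignedWords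

variable {n : ℕ}

theorem map_snd_signedWord (e : ℤˣ) (Rs : List (List (Fin n))) :
    (signedWord e Rs).map Prod.snd = Rs.flatten := by
  induction Rs generalizing e with
  | nil => rfl
  | cons R Rs ih => simp [signedWord, ih, Function.comp_def]

theorem length_signedWord (e : ℤˣ) (Rs : List (List (Fin n))) :
    (signedWord e Rs).length = (Rs.map List.length).sum := by
  rw [← List.length_map (f := Prod.snd), map_snd_signedWord, List.length_flatten]

theorem map_signMul_signedWord (e e' : ℤˣ) (Rs : List (List (Fin n))) :
    (signedWord e' Rs).map (signMul e) = signedWord (e * e') Rs := by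
  induction Rs generalizing e' with
  | nil => rfl
  | cons R Rs ih => simp [signedWord, ih, signMul, Function.comp_def]

theorem signedWord_eq_map_signMul (e : ℤˣ) (Rs : List (List (Fin n))) :
    signedWord e Rs = (signedWord 1 Rs).map (signMul e) := by
  rw [map_signMul_signedWord, mul_one]

theorem IsBlockList.nodup_signedWord {Rs : List (List (Fin n))} (h : IsBlockList Rs) (e : ℤˣ) :
    (signedWord e Rs).Nodup :=
  List.Nodup.of_map Prod.snd (by rw [map_snd_signedWord]; exact h.2)

theorem IsBlockList.nodup_signedWord_append {Rs : List (List (Fin n))} (h : IsBlockList Rs) :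
    (signedWord 1 Rs ++ signedWord (-1) Rs).Nodup := by
  refine (h.nodup_signedWord 1).append (h.nodup_signedWord (-1)) fun x hx hx' => ?_
  rw [signedWord_eq_map_signMul, List.mem_map] at hx'
  obtain ⟨y, hy, rfl⟩ := hx'
  have hinj := List.inj_on_of_nodup_map
    (by rw [map_snd_signedWord]; exact h.2 : ((signedWord 1 Rs).map Prod.snd).Nodup) hx hy rfl
  have hsign : -1 * y.1 = y.1 := congrArg Prod.fst hinj
  exact units_ne_neg_self y.1 (hsign.symm.trans (neg_one_mul _))

theorem exists_signedWord_eq_cons {Rs : List (List (Fin n))} (h : IsBlockList Rs)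
    (h₀ : Rs ≠ []) : ∃ a, ∀ e, ∃ t, signedWord e Rs = (e, a) :: t := by
  rcases Rs with - | ⟨- | ⟨a, R⟩, Rs⟩
  · exact absurd rfl h₀
  · exact absurd rfl (h.1 _ List.mem_cons_self).1
  · exact ⟨a, fun e => ⟨_, rfl⟩⟩

theorem exists_signedWord_eq_of_isChain (x : SignedIndex n) (t : List (SignedIndex n))
    (h : (x :: t).IsChain fun y z => y.1 = z.1 → y.2 < z.2) :
    ∃ R Rs, (∀ S ∈ (x.2 :: R) :: Rs, S ≠ [] ∧ S.Pairwise (· < ·)) ∧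
      signedWord x.1 ((x.2 :: R) :: Rs) = x :: t := by
  induction t generalizing x with
  | nil => exact ⟨[], [], by simp, by simp [signedWord]⟩
  | cons y t ih =>
    rw [List.isChain_cons_cons] at h
    obtain ⟨R, Rs, hblocks, hword⟩ := ih y h.2
    rcases eq_or_ne x.1 y.1 with hxy | hxy
    · refine ⟨y.2 :: R, Rs, ?_, by rw [← hword, ← hxy]; simp [signedWord]⟩
      rw [List.forall_mem_cons] at hblocks ⊢
      refine ⟨⟨List.cons_ne_nil _ _, ?_⟩, hblocks.2⟩
      rw [← List.isChain_iff_pairwise, List.isChain_cons_cons, List.isChain_iff_pairwise]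
      exact ⟨h.1 hxy, hblocks.1.2⟩
    · have hneg : y.1 = -x.1 := Int.units_ne_iff_eq_neg.1 hxy.symm
      exact ⟨[], (y.2 :: R) :: Rs, List.forall_mem_cons.2 ⟨by simp, hblocks⟩,
        by rw [← hword, hneg]; simp [signedWord]⟩

theorem fst_getLast_signedWord {Rs : List (List (Fin n))} (hRs : ∀ R ∈ Rs, R ≠ []) (e : ℤˣ)
    (hne : signedWord e Rs ≠ []) :
    ((signedWord e Rs).getLast hne).1 = e * (-1) ^ (Rs.length + 1) := by
  induction Rs generalizing e with
  | nil => exact absurd rfl hne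
  | cons R Rs ih =>
    rw [List.forall_mem_cons] at hRs
    by_cases hword : signedWord (-e) Rs = []
    · have hnil : Rs = [] := by
        by_contra hcons
        obtain ⟨S, Rs, rfl⟩ := List.exists_cons_of_ne_nil hcons
        simp [signedWord, hRs.2 S List.mem_cons_self] at hword
      simp [signedWord, hnil]
    · simp only [signedWord, List.getLast_append_of_ne_nil _ hword, ih hRs.2, List.length_cons,
        pow_succ _ (Rs.length + 1), neg_mul, mul_neg, mul_one]

end SignedWords

section FormPerm

open Equiv.Perm

variable {α : Type*} [DecidableEq α] [Fintype α] {σ : Equiv.Perm α}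

theorem formPerm_iterate_mem_cycleFactorsFinset {x : α} {r : ℕ} (hr : 2 ≤ r)
    (hd : (List.iterate σ x r).Nodup) (hx : (σ ^ r) x = x) :
    (List.iterate σ x r).formPerm ∈ σ.cycleFactorsFinset := by
  refine mem_cycleFactorsFinset_iff.2
    ⟨List.isCycle_formPerm hd (by rwa [List.length_iterate]), fun y hy => ?_⟩
  obtain ⟨i, hi, rfl⟩ := List.getElem_of_mem (List.mem_toFinset.1 (List.support_formPerm_le _ hy))
  rw [List.formPerm_apply_getElem _ hd]
  simp only [List.length_iterate] at hi
  simp only [List.getElem_iterate, List.length_iterate, ← Function.iterate_succ_apply' σ i x]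
  rcases Nat.lt_or_ge (i + 1) r with h | h
  · rw [Nat.mod_eq_of_lt h]
  · obtain rfl : r = i + 1 := by omega
    rw [Nat.mod_self, Function.iterate_zero_apply, iterate_eq_pow, hx]

theorem support_formPerm_of_mem_cycleFactorsFinset {l : List α} (hd : l.Nodup)
    (hl : l.formPerm ∈ σ.cycleFactorsFinset) : l.formPerm.support = l.toFinset :=
  List.support_formPerm_of_nodup l hd fun x hx =>
    (mem_cycleFactorsFinset_iff.1 hl).1.ne_one (by rw [hx, List.formPerm_singleton])

theorem formPerm_eq_cycleOf_of_mem_cycleFactorsFinset {l : List α} (hd : l.Nodup)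
    (hl : l.formPerm ∈ σ.cycleFactorsFinset) {x : α} (hx : x ∈ l) : l.formPerm = σ.cycleOf x :=
  cycle_is_cycleOf (by
    rwa [support_formPerm_of_mem_cycleFactorsFinset hd hl, List.mem_toFinset]) hl

theorem pow_apply_head_of_formPerm_mem_cycleFactorsFinset {x : α} {t : List α}
    (hd : (x :: t).Nodup) (hl : (x :: t).formPerm ∈ σ.cycleFactorsFinset) (j : ℕ) :
    (σ ^ j) x = (x :: t)[j % (x :: t).length]'(Nat.mod_lt _ (by simp)) := by
  induction j with
  | zero => simp
  | succ j ih =>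
    have hj : j % (x :: t).length < (x :: t).length := Nat.mod_lt _ (by simp)
    rw [pow_succ', mul_apply, ih, ← (mem_cycleFactorsFinset_iff.1 hl).2 _ (by
        rw [support_formPerm_of_mem_cycleFactorsFinset hd hl, List.mem_toFinset]
        exact List.getElem_mem hj), List.formPerm_apply_getElem _ hd]
    simp only [Nat.mod_add_mod]

theorem eq_iterate_of_formPerm_mem_cycleFactorsFinset {x : α} {t : List α} (hd : (x :: t).Nodup)
    (hl : (x :: t).formPerm ∈ σ.cycleFactorsFinset) :
    x :: t = List.iterate σ x (x :: t).length := by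
  refine List.ext_getElem (List.length_iterate _ _ _).symm fun i hi _ => ?_
  rw [List.getElem_iterate, iterate_eq_pow,
    pow_apply_head_of_formPerm_mem_cycleFactorsFinset hd hl]
  simp only [Nat.mod_eq_of_lt hi]

theorem pow_length_apply_of_formPerm_mem_cycleFactorsFinset {x : α} {t : List α}
    (hd : (x :: t).Nodup) (hl : (x :: t).formPerm ∈ σ.cycleFactorsFinset) :
    (σ ^ (x :: t).length) x = x := by
  rw [pow_apply_head_of_formPerm_mem_cycleFactorsFinset hd hl]
  simp only [Nat.mod_self, List.getElem_cons_zero]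

end FormPerm

section OrbitBlocks

variable {n : ℕ} {σ : Equiv.Perm (SignedIndex n)} {a : Fin n} {Rs Rs' : List (List (Fin n))}
  {C C' : Finset (Equiv.Perm (SignedIndex n))}

theorem map_iterate_of_semiconj {α β : Type*} {f : α → α} {g : β → β} {φ : α → β}
    (h : Function.Semiconj φ f g) (x : α) (r : ℕ) :
    (List.iterate f x r).map φ = List.iterate g (φ x) r :=
  List.ext_getElem (by simp) fun i _ _ => by
    simpa only [List.getElem_map, List.getElem_iterate] using h.iterate_right i x

/-- `R_1, R_2, …` are the blocks that the orbit of `a` runs through: the first `∑ |R_i|` points of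
the orbit spell `R_1, -R_2, R_3, …`, and the next point is `a` with the sign that the alternation
prescribes. The orbit closes up at this point if the number of blocks is even (type (b)), and
continues with `-R_1, R_2, …` if it is odd (type (c)). -/
structure IsOrbitBlocks (σ : Equiv.Perm (SignedIndex n)) (a : Fin n) (Rs : List (List (Fin n))) :
    Prop where
  isBlockList : IsBlockList Rs
  ne_nil : Rs ≠ []
  signedWord_eq : signedWord 1 Rs = List.iterate σ (1, a) (Rs.map List.length).sum
  pow_apply : (σ ^ (Rs.map List.length).sum) (1, a) = ((-1) ^ Rs.length, a)

/-- `C` is a pair of cycles of type (b) or a cycle of type (c), with the blocks `Rs`. -/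
def IsTypeBOrC (σ : Equiv.Perm (SignedIndex n)) (Rs : List (List (Fin n)))
    (C : Finset (Equiv.Perm (SignedIndex n))) : Prop :=
  IsTypeB σ Rs C ∨ IsTypeC σ Rs C

theorem IsTypeB.even_length (h : IsTypeB σ Rs C) : Even Rs.length := by
  obtain ⟨m, -, hm⟩ := h.2.1
  exact ⟨m, hm.trans (two_mul m)⟩

theorem IsTypeC.odd_length (h : IsTypeC σ Rs C) : Odd Rs.length := by
  obtain ⟨m, hm, hlen⟩ := h.2.1
  exact ⟨m - 1, by omega⟩

theorem IsTypeB.formPerm_mem (h : IsTypeB σ Rs C) (e : ℤˣ) :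
    (signedWord e Rs).formPerm ∈ σ.cycleFactorsFinset := by
  refine h.2.2.2 (h.2.2.1 ▸ ?_)
  rcases Int.units_eq_one_or e with rfl | rfl <;> simp

theorem IsTypeC.formPerm_mem (h : IsTypeC σ Rs C) :
    (signedWord 1 Rs ++ signedWord (-1) Rs).formPerm ∈ σ.cycleFactorsFinset :=
  h.2.2.2 (by rw [h.2.2.1]; exact Finset.mem_singleton_self _)

theorem IsTypeB.exists_isOrbitBlocks (h : IsTypeB σ Rs C) : ∃ a, IsOrbitBlocks σ a Rs := by
  have hne : Rs ≠ [] := by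
    obtain ⟨m, hm, hlen⟩ := h.2.1
    exact List.ne_nil_of_length_pos (by omega)
  obtain ⟨a, ha⟩ := exists_signedWord_eq_cons h.1 hne
  obtain ⟨t, ht⟩ := ha 1
  have hd := h.1.nodup_signedWord 1
  have hl := h.formPerm_mem 1
  rw [ht] at hd hl
  refine ⟨a, h.1, hne, ?_, ?_⟩
  · rw [← length_signedWord 1, ht]
    exact eq_iterate_of_formPerm_mem_cycleFactorsFinset hd hl
  · rw [← length_signedWord 1, ht, h.even_length.neg_one_pow]
    exact pow_length_apply_of_formPerm_mem_cycleFactorsFinset hd hl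

theorem IsTypeC.exists_isOrbitBlocks (h : IsTypeC σ Rs C) : ∃ a, IsOrbitBlocks σ a Rs := by
  have hne : Rs ≠ [] := by
    rintro rfl
    exact Nat.not_odd_zero h.odd_length
  obtain ⟨a, ha⟩ := exists_signedWord_eq_cons h.1 hne
  obtain ⟨t, ht⟩ := ha 1
  obtain ⟨t', ht'⟩ := ha (-1)
  have hd := h.1.nodup_signedWord_append
  have hl := h.formPerm_mem
  have hword : signedWord 1 Rs ++ signedWord (-1) Rs = (1, a) :: (t ++ signedWord (-1) Rs) := by
    rw [ht, List.cons_append]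
  rw [hword] at hd hl
  have horbit := eq_iterate_of_formPerm_mem_cycleFactorsFinset hd hl
  rw [← hword, List.length_append, length_signedWord, length_signedWord, List.iterate_add] at horbit
  obtain ⟨hfst, hsnd⟩ := List.append_inj horbit (by rw [length_signedWord, List.length_iterate])
  refine ⟨a, h.1, hne, hfst, ?_⟩
  have hlen : (Rs.map List.length).sum = t'.length + 1 := by
    rw [← length_signedWord (-1), ht', List.length_cons]
  rw [ht', hlen, List.iterate, ← hlen, Equiv.Perm.iterate_eq_pow] at hsnd
  rw [h.odd_length.neg_one_pow]
  exact (List.cons.inj hsnd).1.symm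

theorem IsTypeBOrC.exists_isOrbitBlocks (h : IsTypeBOrC σ Rs C) : ∃ a, IsOrbitBlocks σ a Rs :=
  h.elim IsTypeB.exists_isOrbitBlocks IsTypeC.exists_isOrbitBlocks

theorem IsOrbitBlocks.length_le_sum (h : IsOrbitBlocks σ a Rs) :
    Rs.length ≤ (Rs.map List.length).sum := by
  refine (List.length_map (as := Rs) List.length).symm.trans_le
    (List.length_le_sum_of_one_le _ fun i hi => ?_)
  obtain ⟨R, hR, rfl⟩ := List.mem_map.1 hi
  exact List.length_pos_of_ne_nil (h.isBlockList.1 R hR).1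

theorem IsOrbitBlocks.length_pos (h : IsOrbitBlocks σ a Rs) : 0 < Rs.length :=
  List.length_pos_of_ne_nil h.ne_nil

theorem IsOrbitBlocks.signedWord_eq_iterate (h : IsOrbitBlocks σ a Rs) (hσ : IsSigned σ) (e : ℤˣ) :
    signedWord e Rs = List.iterate σ (e, a) (Rs.map List.length).sum := by
  rw [signedWord_eq_map_signMul, h.signedWord_eq, map_iterate_of_semiconj (fun x => (hσ e x).symm),
    signMul, mul_one]

theorem IsOrbitBlocks.isTypeB (h : IsOrbitBlocks σ a Rs) (hσ : IsSigned σ)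
    (heven : Even Rs.length) :
    IsTypeB σ Rs {(signedWord 1 Rs).formPerm, (signedWord (-1) Rs).formPerm} := by
  obtain ⟨m, hm⟩ := heven
  have hlen := h.length_pos
  have hsum := h.length_le_sum
  have hmem (e : ℤˣ) : (signedWord e Rs).formPerm ∈ σ.cycleFactorsFinset := by
    have hd := h.isBlockList.nodup_signedWord e
    rw [h.signedWord_eq_iterate hσ] at hd ⊢
    refine formPerm_iterate_mem_cycleFactorsFinset (by omega) hd ?_
    rw [(hσ.pow _).apply_mk, h.pow_apply, hm, ← two_mul, pow_mul, neg_one_sq, one_pow, signMul,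
      mul_one]
  refine ⟨h.isBlockList, ⟨m, by omega, by omega⟩, rfl, fun c hc => ?_⟩
  rcases Finset.mem_insert.1 hc with rfl | hc
  · exact hmem 1
  · rw [Finset.mem_singleton.1 hc]
    exact hmem (-1)

theorem IsOrbitBlocks.isTypeC (h : IsOrbitBlocks σ a Rs) (hσ : IsSigned σ)
    (hodd : Odd Rs.length) :
    IsTypeC σ Rs {(signedWord 1 Rs ++ signedWord (-1) Rs).formPerm} := by
  have hlen := h.length_pos
  have hsum := h.length_le_sum
  have hpow := h.pow_apply
  rw [hodd.neg_one_pow] at hpow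
  have hword : signedWord 1 Rs ++ signedWord (-1) Rs =
      List.iterate σ (1, a) ((Rs.map List.length).sum + (Rs.map List.length).sum) := by
    rw [List.iterate_add, Equiv.Perm.iterate_eq_pow, hpow, h.signedWord_eq_iterate hσ,
      h.signedWord_eq_iterate hσ]
  obtain ⟨m, hm⟩ := hodd
  refine ⟨h.isBlockList, ⟨m + 1, by omega, by omega⟩, rfl, Finset.singleton_subset_iff.2 ?_⟩
  have hd := h.isBlockList.nodup_signedWord_append
  rw [hword] at hd ⊢
  refine formPerm_iterate_mem_cycleFactorsFinset (by omega) hd ?_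
  rw [pow_add, Equiv.Perm.mul_apply, hpow, (hσ.pow _).apply_mk, hpow, signMul, neg_mul_neg,
    one_mul]

theorem IsOrbitBlocks.exists_isTypeBOrC (h : IsOrbitBlocks σ a Rs) (hσ : IsSigned σ) :
    ∃ C, IsTypeBOrC σ Rs C :=
  (Nat.even_or_odd Rs.length).elim (fun hb => ⟨_, Or.inl (h.isTypeB hσ hb)⟩)
    fun hc => ⟨_, Or.inr (h.isTypeC hσ hc)⟩

theorem IsOrbitBlocks.flatten_eq (h : IsOrbitBlocks σ a Rs) :
    Rs.flatten = (List.range (Rs.map List.length).sum).map fun j => ((σ ^ j) (1, a)).2 := by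
  rw [← map_snd_signedWord 1, h.signedWord_eq, ← List.range_map_iterate, List.map_map]
  simp only [Function.comp_def, Equiv.Perm.iterate_eq_pow]

theorem IsOrbitBlocks.mem_flatten_iff (h : IsOrbitBlocks σ a Rs) {k : Fin n} :
    k ∈ Rs.flatten ↔ ∃ j < (Rs.map List.length).sum, ((σ ^ j) (1, a)).2 = k := by
  simp only [h.flatten_eq, List.mem_map, List.mem_range]

theorem IsOrbitBlocks.sum_pos (h : IsOrbitBlocks σ a Rs) : 0 < (Rs.map List.length).sum :=
  h.length_pos.trans_le h.length_le_sum

theorem IsOrbitBlocks.mem_flatten (h : IsOrbitBlocks σ a Rs) : a ∈ Rs.flatten :=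
  h.mem_flatten_iff.2 ⟨0, h.sum_pos, rfl⟩

theorem IsOrbitBlocks.pow_apply_of_mem (h : IsOrbitBlocks σ a Rs) (hσ : IsSigned σ) {k : Fin n}
    (hk : k ∈ Rs.flatten) :
    (σ ^ (Rs.map List.length).sum) (1, k) = ((-1) ^ Rs.length, k) := by
  obtain ⟨j, -, hj⟩ := h.mem_flatten_iff.1 hk
  rw [eq_signMul_of_snd_eq (x := (1, k)) hj.symm, hσ.pow_apply_signMul_eq (e := (-1) ^ Rs.length)
    (h.pow_apply.trans (by rw [signMul, mul_one])), ← eq_signMul_of_snd_eq hj.symm, signMul,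
    mul_one]

theorem mem_signedWord_of_mem_flatten {k : Fin n} (hk : k ∈ Rs.flatten) :
    ∃ e, (e, k) ∈ signedWord 1 Rs ∧ (-e, k) ∈ signedWord (-1) Rs := by
  rw [← map_snd_signedWord 1 Rs, List.mem_map] at hk
  obtain ⟨⟨e, k⟩, hx, rfl⟩ := hk
  refine ⟨e, hx, ?_⟩
  rw [signedWord_eq_map_signMul]
  exact List.mem_map.2 ⟨_, hx, by rw [signMul, neg_one_mul]⟩

theorem IsTypeB.eq_pair_cycleOf (h : IsTypeB σ Rs C) {k : Fin n} (hk : k ∈ Rs.flatten) :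
    C = {σ.cycleOf (1, k), σ.cycleOf (-1, k)} := by
  obtain ⟨e, he, hneg⟩ := mem_signedWord_of_mem_flatten hk
  rw [h.2.2.1, formPerm_eq_cycleOf_of_mem_cycleFactorsFinset (h.1.nodup_signedWord 1)
      (h.formPerm_mem 1) he, formPerm_eq_cycleOf_of_mem_cycleFactorsFinset
      (h.1.nodup_signedWord (-1)) (h.formPerm_mem (-1)) hneg]
  rcases Int.units_eq_one_or e with rfl | rfl
  · rfl
  · rw [neg_neg, Finset.pair_comm]

-- The two cycles coincide here, so that both types are described by the same pair.
theorem IsTypeC.eq_pair_cycleOf (h : IsTypeC σ Rs C) {k : Fin n} (hk : k ∈ Rs.flatten) :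
    C = {σ.cycleOf (1, k), σ.cycleOf (-1, k)} := by
  obtain ⟨e, he, hneg⟩ := mem_signedWord_of_mem_flatten hk
  have hcycle {x} (hx : x ∈ signedWord 1 Rs ++ signedWord (-1) Rs) :=
    formPerm_eq_cycleOf_of_mem_cycleFactorsFinset h.1.nodup_signedWord_append h.formPerm_mem hx
  have hpos := hcycle (List.mem_append_left _ he)
  have hneg := hcycle (List.mem_append_right _ hneg)
  rw [h.2.2.1]
  rcases Int.units_eq_one_or e with rfl | rfl
  · rw [← hpos, ← hneg, Finset.pair_eq_singleton]
  · rw [neg_neg] at hneg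
    rw [← hpos, ← hneg, Finset.pair_eq_singleton]

theorem IsTypeBOrC.eq_pair_cycleOf (h : IsTypeBOrC σ Rs C) {k : Fin n} (hk : k ∈ Rs.flatten) :
    C = {σ.cycleOf (1, k), σ.cycleOf (-1, k)} :=
  h.elim (fun hb => hb.eq_pair_cycleOf hk) fun hc => hc.eq_pair_cycleOf hk

theorem IsTypeBOrC.eq_of_mem_flatten (h : IsTypeBOrC σ Rs C) (h' : IsTypeBOrC σ Rs' C')
    {k : Fin n} (hk : k ∈ Rs.flatten) (hk' : k ∈ Rs'.flatten) : C = C' :=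
  (h.eq_pair_cycleOf hk).trans (h'.eq_pair_cycleOf hk').symm

/-- The indices `|x|` of the points `x` that are moved by one of the cycles in `C`. -/
def absSupport (C : Finset (Equiv.Perm (SignedIndex n))) : Finset (Fin n) :=
  (C.biUnion Equiv.Perm.support).image Prod.snd

theorem IsTypeBOrC.biUnion_support (h : IsTypeBOrC σ Rs C) :
    C.biUnion Equiv.Perm.support = (signedWord 1 Rs ++ signedWord (-1) Rs).toFinset := by
  rcases h with hb | hc
  · rw [hb.2.2.1, Finset.biUnion_insert, Finset.singleton_biUnion, List.toFinset_append,
      support_formPerm_of_mem_cycleFactorsFinset (hb.1.nodup_signedWord 1) (hb.formPerm_mem 1),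
      support_formPerm_of_mem_cycleFactorsFinset (hb.1.nodup_signedWord (-1))
        (hb.formPerm_mem (-1))]
  · rw [hc.2.2.1, Finset.singleton_biUnion,
      support_formPerm_of_mem_cycleFactorsFinset hc.1.nodup_signedWord_append hc.formPerm_mem]

theorem IsTypeBOrC.absSupport_eq (h : IsTypeBOrC σ Rs C) : absSupport C = Rs.flatten.toFinset := by
  ext k
  simp only [absSupport, h.biUnion_support, Finset.mem_image, List.mem_toFinset, List.mem_append]
  simp only [or_and_right, exists_or, ← List.mem_map (f := Prod.snd), map_snd_signedWord, or_self]

theorem IsTypeBOrC.card_absSupport (h : IsTypeBOrC σ Rs C) :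
    (absSupport C).card = (Rs.map List.length).sum := by
  have hblocks : IsBlockList Rs := h.elim And.left And.left
  rw [h.absSupport_eq, List.toFinset_card_of_nodup hblocks.2, List.length_flatten]

theorem IsTypeBOrC.even_length_iff (h : IsTypeBOrC σ Rs C) (h' : IsTypeBOrC σ Rs' C)
    (hσ : IsSigned σ) : Even Rs.length ↔ Even Rs'.length := by
  obtain ⟨a, ha⟩ := h.exists_isOrbitBlocks
  obtain ⟨a', ha'⟩ := h'.exists_isOrbitBlocks
  have hmem : a ∈ Rs'.flatten := by
    rw [← List.mem_toFinset, ← h'.absSupport_eq, h.absSupport_eq, List.mem_toFinset]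
    exact ha.mem_flatten
  have hpow := ha.pow_apply
  rw [← h.card_absSupport, h'.card_absSupport, ha'.pow_apply_of_mem hσ hmem] at hpow
  have hsign : (-1 : ℤˣ) ^ Rs'.length = (-1) ^ Rs.length := congrArg Prod.fst hpow
  rw [← neg_one_pow_eq_one_iff_even (R := ℤˣ) (by decide), ← hsign,
    neg_one_pow_eq_one_iff_even (by decide)]

theorem IsTypeBOrC.mem_evenTypeB_union_oddTypeC_iff (h : IsTypeBOrC σ Rs C) (hσ : IsSigned σ) :
    C ∈ evenTypeB σ ∪ oddTypeC σ ↔ (Even Rs.length ↔ Even (Rs.map List.length).sum) := by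
  constructor
  · rintro (⟨Rs', hb, heven⟩ | ⟨Rs', hc, hodd⟩)
    · rw [h.even_length_iff (.inl hb) hσ, ← h.card_absSupport, IsTypeBOrC.card_absSupport (.inl hb)]
      exact iff_of_true hb.even_length heven
    · rw [h.even_length_iff (.inr hc) hσ, ← h.card_absSupport, IsTypeBOrC.card_absSupport (.inr hc)]
      exact iff_of_false (Nat.not_even_iff_odd.2 hc.odd_length) (Nat.not_even_iff_odd.2 hodd)
  · intro hparity
    rcases h with hb | hc
    · exact Or.inl ⟨Rs, hb, hparity.1 hb.even_length⟩
    · refine Or.inr ⟨Rs, hc, Nat.not_even_iff_odd.1 fun heven => ?_⟩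
      exact Nat.not_even_iff_odd.2 hc.odd_length (hparity.2 heven)

theorem disjoint_evenTypeB_oddTypeC : Disjoint (evenTypeB σ) (oddTypeC σ) := by
  refine Set.disjoint_left.2 ?_
  rintro C ⟨Rs, hb, heven⟩ ⟨Rs', hc, hodd⟩
  rw [← IsTypeBOrC.card_absSupport (.inl hb), IsTypeBOrC.card_absSupport (.inr hc)] at heven
  exact Nat.not_even_iff_odd.2 hodd heven

end OrbitBlocks

section Existence

variable {n : ℕ} {σ : Equiv.Perm (SignedIndex n)}

/-- `|σ(x)| ≥ |x|` whenever `x` and `σ(x)` have the same sign. -/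
def IsExpanding (σ : Equiv.Perm (SignedIndex n)) : Prop :=
  ∀ x, (σ x).1 = x.1 → x.2 ≤ (σ x).2

theorem IsExpanding.exists_fst_apply_ne (he : IsExpanding σ) {x : SignedIndex n} (hx : σ x ≠ x) :
    ∃ j, (σ ((σ ^ j) x)).1 ≠ ((σ ^ j) x).1 := by
  by_contra! hconst
  have hsign (j : ℕ) : ((σ ^ j) x).1 = x.1 := by
    induction j with
    | zero => rfl
    | succ j ih => rw [pow_succ', Equiv.Perm.mul_apply, hconst, ih]
  have hmono : Monotone fun j : ℕ => ((σ ^ j) x).2 := monotone_nat_of_le_succ fun j => by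
    rw [pow_succ', Equiv.Perm.mul_apply]
    exact he _ (hconst j)
  have hle : (σ x).2 ≤ x.2 := by
    simpa only [pow_one, pow_orderOf_eq_one, Equiv.Perm.one_apply] using
      hmono (Nat.one_le_iff_ne_zero.2 (orderOf_pos σ).ne')
  exact hx (Prod.ext (hsign 1) (hle.antisymm (he x (hsign 1))))

theorem IsExpanding.isChain_iterate (he : IsExpanding σ) {x : SignedIndex n} (hx : σ x ≠ x)
    (r : ℕ) : (List.iterate σ x r).IsChain fun y z => y.1 = z.1 → y.2 < z.2 := by
  rw [List.isChain_iff_getElem]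
  intro i hi hsign
  simp only [List.getElem_iterate, Function.iterate_succ_apply'] at hsign ⊢
  refine (he _ hsign.symm).lt_of_ne fun habs => hx ?_
  refine (σ.injective.iterate i) ?_
  rw [← Function.iterate_succ_apply, Function.iterate_succ_apply']
  exact (Prod.ext hsign habs).symm

theorem IsSigned.nodup_map_snd_iterate (hσ : IsSigned σ) (a : Fin n) :
    ((List.iterate σ (1, a) (Function.minimalPeriod (absMap σ) a)).map Prod.snd).Nodup := by
  rw [map_iterate_of_semiconj hσ.snd_apply, ← List.range_map_iterate]
  exact Cycle.nodup_coe_iff.1 Function.nodup_periodicOrbit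

theorem IsSigned.pow_minimalPeriod_apply (hσ : IsSigned σ) (a : Fin n) :
    ∃ e, (σ ^ Function.minimalPeriod (absMap σ) a) (1, a) = signMul e (1, a) :=
  ⟨_, eq_signMul_of_snd_eq (by rw [hσ.snd_pow_apply, Function.iterate_minimalPeriod])⟩

theorem exists_isOrbitBlocks_of_apply_eq (hσ : IsSigned σ) (he : IsExpanding σ)
    {p : SignedIndex n} {a : Fin n} (hp : p.1 = -1) (hpa : σ p = (1, a)) :
    ∃ Rs, IsOrbitBlocks σ a Rs := by
  have hmoved : σ (1, a) ≠ (1, a) := fun hfix => by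
    rw [σ.injective (hpa.trans hfix.symm)] at hp
    have hsign : (1 : ℤˣ) = -1 := hp
    exact absurd hsign (by decide)
  have hnodup := hσ.nodup_map_snd_iterate a
  obtain ⟨e, hpow⟩ := hσ.pow_minimalPeriod_apply a
  obtain ⟨s, hs⟩ := Nat.exists_eq_succ_of_ne_zero (Function.minimalPeriod_pos_of_mem_periodicPts
    (hσ.absMap_injective.mem_periodicPts a)).ne'
  rw [hs] at hnodup hpow
  obtain ⟨R, Rs, hblocks, hword⟩ :=
    exists_signedWord_eq_of_isChain (1, a) _ (he.isChain_iterate hmoved (s + 1))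
  change signedWord 1 ((a :: R) :: Rs) = List.iterate σ (1, a) (s + 1) at hword
  have hsum : (((a :: R) :: Rs).map List.length).sum = s + 1 := by
    rw [← length_signedWord 1, hword, List.length_iterate]
  -- The orbit returns to `±a` through `±p`, so the sign of the return is read off the last block.
  have hlast : (σ ^ s) (1, a) = signMul e p := σ.injective <| by
    rw [← Equiv.Perm.mul_apply, ← pow_succ', hpow, hσ, hpa]
  have hsign : e = (-1) ^ ((a :: R) :: Rs).length := by
    have hfst := fst_getLast_signedWord (fun S hS => (hblocks S hS).1) 1 (by simp [hword])
    simp only [hword, List.getLast_eq_getElem, List.getElem_iterate, List.length_iterate,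
      Nat.add_sub_cancel, Equiv.Perm.iterate_eq_pow, hlast, signMul, hp, one_mul, pow_succ,
      mul_neg_one, neg_inj] at hfst
    rw [hfst, List.length_cons, pow_succ, mul_neg_one]
  exact ⟨(a :: R) :: Rs, ⟨hblocks, by rwa [← map_snd_signedWord 1, hword]⟩, List.cons_ne_nil _ _,
    by rw [hsum, hword], by rw [hsum, hpow, ← hsign, signMul, mul_one]⟩

theorem exists_isOrbitBlocks (hσ : IsSigned σ) (he : IsExpanding σ) {x : SignedIndex n}
    (hx : σ x ≠ x) : ∃ j Rs, IsOrbitBlocks σ ((σ ^ j) x).2 Rs := by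
  obtain ⟨j, hj⟩ := he.exists_fst_apply_ne hx
  refine ⟨j + 1, exists_isOrbitBlocks_of_apply_eq hσ he
    (p := signMul (σ ((σ ^ j) x)).1 ((σ ^ j) x)) ?_ ?_⟩
  · rw [signMul, Int.units_ne_iff_eq_neg.1 hj, neg_mul, Int.units_mul_self]
  · rw [hσ, signMul, Int.units_mul_self, pow_succ', Equiv.Perm.mul_apply]

end Existence

section SignedMatrix

open Matrix

variable (𝕜 : Type*) [Field 𝕜] {n : ℕ} {σ : Equiv.Perm (SignedIndex n)} {a : Fin n}
  {Rs : List (List (Fin n))}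

/-- The vector `±ε_k` of the signed index `±k`. -/
def signedVec (x : SignedIndex n) : Fin n → 𝕜 :=
  Pi.single x.2 ((x.1 : ℤ) : 𝕜)

theorem units_cast_mul_self (e : ℤˣ) : ((e : ℤ) : 𝕜) * ((e : ℤ) : 𝕜) = 1 := by
  rw [← Int.cast_mul, ← Units.val_mul, Int.units_mul_self, Units.val_one, Int.cast_one]

theorem signedVec_signMul (e : ℤˣ) (x : SignedIndex n) :
    signedVec 𝕜 (signMul e x) = ((e : ℤ) : 𝕜) • signedVec 𝕜 x := by
  rw [signedVec, signedVec, ← Pi.single_smul, smul_eq_mul, signMul, Units.val_mul, Int.cast_mul]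

theorem signedMatrix_one_fst (i : Fin n) : signedMatrix 𝕜 σ i = signedVec 𝕜 (σ (1, i)) := by
  ext j
  rw [signedMatrix, of_apply]
  obtain ⟨e, k⟩ := σ (1, i)
  rcases Int.units_eq_one_or e with rfl | rfl <;>
    simp [signedVec, Pi.single_apply, Prod.ext_iff, eq_comm (a := k), units_ne_neg_self,
      (units_ne_neg_self (1 : ℤˣ)).symm]

theorem IsSigned.signedMatrix_row (hσ : IsSigned σ) (x : SignedIndex n) :
    signedMatrix 𝕜 σ x.2 = ((x.1 : ℤ) : 𝕜) • signedVec 𝕜 (σ x) := by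
  have hx : (1, x.2) = signMul x.1 x := by rw [signMul, Int.units_mul_self]
  rw [signedMatrix_one_fst, hx, hσ, signedVec_signMul]

theorem IsSigned.signedVec_vecMul (hσ : IsSigned σ) (x : SignedIndex n) :
    signedVec 𝕜 x ᵥ* signedMatrix 𝕜 σ = signedVec 𝕜 (σ x) := by
  rw [signedVec, single_vecMul, Matrix.row, hσ.signedMatrix_row 𝕜, smul_smul,
    units_cast_mul_self 𝕜, one_smul]

theorem IsSigned.signedMatrix_apply (hσ : IsSigned σ) (x : SignedIndex n) :
    signedMatrix 𝕜 σ x.2 (σ x).2 = ((x.1 : ℤ) : 𝕜) * (((σ x).1 : ℤ) : 𝕜) := by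
  rw [hσ.signedMatrix_row 𝕜, Pi.smul_apply, signedVec, Pi.single_eq_same, smul_eq_mul]

theorem IsSigned.prod_signedMatrix (hσ : IsSigned σ) (x : SignedIndex n) (j : ℕ) :
    ∏ l ∈ Finset.range j, signedMatrix 𝕜 σ ((σ ^ l) x).2 ((σ ^ (l + 1)) x).2 =
      ((x.1 : ℤ) : 𝕜) * ((((σ ^ j) x).1 : ℤ) : 𝕜) := by
  induction j with
  | zero => exact (units_cast_mul_self 𝕜 x.1).symm
  | succ j ih =>
    rw [Finset.prod_range_succ, ih, pow_succ', Equiv.Perm.mul_apply, hσ.signedMatrix_apply 𝕜,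
      mul_assoc, ← mul_assoc ((((σ ^ j) x).1 : ℤ) : 𝕜), units_cast_mul_self 𝕜, one_mul]

theorem IsOrbitBlocks.cycleVector_eq (h : IsOrbitBlocks σ a Rs) (hσ : IsSigned σ) :
    cycleVector 𝕜 σ Rs = ∑ j ∈ Finset.range (Rs.map List.length).sum,
      (-1 : 𝕜) ^ j • signedVec 𝕜 ((σ ^ j) (1, a)) := by
  obtain ⟨r, hr⟩ := Nat.exists_eq_succ_of_ne_zero h.sum_pos.ne'
  have hflatten : Rs.flatten =
      a :: (List.range r).map fun j => ((σ ^ (j + 1)) (1, a)).2 := by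
    rw [h.flatten_eq, hr, List.range_succ_eq_map, List.map_cons, List.map_map]
    rfl
  rw [cycleVector, hflatten]
  refine Finset.sum_congr rfl fun j _ => ?_
  rw [hσ.prod_signedMatrix 𝕜, signedVec, ← Pi.single_smul, smul_eq_mul, Units.val_one, Int.cast_one,
    one_mul]

theorem IsOrbitBlocks.cycleVector_apply_self (h : IsOrbitBlocks σ a Rs) (hσ : IsSigned σ) :
    cycleVector 𝕜 σ Rs a = 1 := by
  have hnodup := h.isBlockList.2
  rw [h.flatten_eq] at hnodup
  rw [h.cycleVector_eq 𝕜 hσ, Finset.sum_apply,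
    Finset.sum_eq_single_of_mem 0 (Finset.mem_range.2 h.sum_pos)]
  · simp [signedVec]
  · intro j hj hj₀
    rw [Pi.smul_apply, signedVec, Pi.single_eq_of_ne, smul_zero]
    exact fun heq => hj₀ (List.inj_on_of_nodup_map hnodup (List.mem_range.2 (Finset.mem_range.1 hj))
      (List.mem_range.2 h.sum_pos) heq.symm)

theorem IsOrbitBlocks.cycleVector_apply_of_notMem (h : IsOrbitBlocks σ a Rs) (hσ : IsSigned σ)
    {k : Fin n} (hk : k ∉ Rs.flatten) : cycleVector 𝕜 σ Rs k = 0 := by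
  rw [h.cycleVector_eq 𝕜 hσ, Finset.sum_apply]
  refine Finset.sum_eq_zero fun j hj => ?_
  rw [Pi.smul_apply, signedVec, Pi.single_eq_of_ne, smul_zero]
  exact fun heq => hk (h.mem_flatten_iff.2 ⟨j, Finset.mem_range.1 hj, heq.symm⟩)

variable (σ) in
/-- The row vectors `v` with `v P = -v`, where `P` is the signed matrix of `σ`. -/
def negEigenspace : Submodule 𝕜 (Fin n → 𝕜) :=
  Module.End.eigenspace (signedMatrix 𝕜 σ).vecMulLinear (-1)

variable {𝕜} {v : Fin n → 𝕜}

theorem mem_negEigenspace_iff : v ∈ negEigenspace 𝕜 σ ↔ v ᵥ* signedMatrix 𝕜 σ = -v := by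
  rw [negEigenspace, Module.End.mem_eigenspace_iff, neg_one_smul]
  rfl

theorem IsOrbitBlocks.cycleVector_mem_negEigenspace (h : IsOrbitBlocks σ a Rs) (hσ : IsSigned σ)
    (hparity : Even Rs.length ↔ Even (Rs.map List.length).sum) :
    cycleVector 𝕜 σ Rs ∈ negEigenspace 𝕜 σ := by
  set w : ℕ → Fin n → 𝕜 := fun j => (-1 : 𝕜) ^ j • signedVec 𝕜 ((σ ^ j) (1, a)) with hw
  have hstep (j : ℕ) : w j ᵥ* signedMatrix 𝕜 σ = -w (j + 1) := by
    simp only [hw, smul_vecMul, hσ.signedVec_vecMul 𝕜]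
    rw [pow_succ', pow_succ', Equiv.Perm.mul_apply, neg_one_mul, neg_smul, neg_neg]
  have hclosed : w (Rs.map List.length).sum = w 0 := by
    simp only [hw]
    rw [h.pow_apply, ← neg_one_pow_congr hparity, ← mul_one ((-1 : ℤˣ) ^ Rs.length)]
    change _ • signedVec 𝕜 (signMul _ (1, a)) = _
    rw [signedVec_signMul, smul_smul, Units.val_pow_eq_pow_val, Int.cast_pow, Units.val_neg,
      Units.val_one, Int.cast_neg, Int.cast_one, ← mul_pow, neg_one_mul,
      neg_neg, one_pow, pow_zero, pow_zero, Equiv.Perm.one_apply]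
  have hshift : ∑ j ∈ Finset.range (Rs.map List.length).sum, w (j + 1) =
      ∑ j ∈ Finset.range (Rs.map List.length).sum, w j := by
    have hsum := (Finset.sum_range_succ' w (Rs.map List.length).sum).symm.trans
      (Finset.sum_range_succ w _)
    rwa [hclosed, add_left_inj] at hsum
  rw [mem_negEigenspace_iff, h.cycleVector_eq 𝕜 hσ, sum_vecMul]
  change ∑ j ∈ _, w j ᵥ* _ = -∑ j ∈ _, w j
  simp only [hstep, Finset.sum_neg_distrib, hshift]

/-- The extension of a function on `[n]` to an odd function on `[n] ∪ -[n]`. -/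
def oddExt (v : Fin n → 𝕜) (x : SignedIndex n) : 𝕜 :=
  ((x.1 : ℤ) : 𝕜) * v x.2

theorem oddExt_one (k : Fin n) : oddExt v (1, k) = v k := by
  rw [oddExt, Units.val_one, Int.cast_one, one_mul]

theorem oddExt_eq_zero_iff {x : SignedIndex n} : oddExt v x = 0 ↔ v x.2 = 0 :=
  mul_eq_zero_iff_left (left_ne_zero_of_mul_eq_one (units_cast_mul_self 𝕜 x.1))

theorem IsSigned.oddExt_vecMul (hσ : IsSigned σ) (x : SignedIndex n) :
    oddExt (v ᵥ* signedMatrix 𝕜 σ) (σ x) = oddExt v x := by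
  have hsum : (v ᵥ* signedMatrix 𝕜 σ) (σ x).2 = v x.2 * signedMatrix 𝕜 σ x.2 (σ x).2 := by
    refine Finset.sum_eq_single_of_mem x.2 (Finset.mem_univ _) fun i _ hi => ?_
    change v i * signedMatrix 𝕜 σ i (σ x).2 = 0
    rw [signedMatrix_one_fst, signedVec, Pi.single_eq_of_ne, mul_zero]
    rw [hσ.snd_apply]
    exact fun heq => hi (hσ.absMap_injective heq).symm
  rw [oddExt, hsum, hσ.signedMatrix_apply 𝕜, oddExt, mul_left_comm, mul_left_comm _ ((x.1 : ℤ) : 𝕜),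
    units_cast_mul_self 𝕜, mul_one, mul_comm]

theorem IsSigned.oddExt_pow_apply (hσ : IsSigned σ) (hv : v ∈ negEigenspace 𝕜 σ) (j : ℕ)
    (x : SignedIndex n) : oddExt v ((σ ^ j) x) = (-1) ^ j * oddExt v x := by
  induction j with
  | zero => rw [pow_zero, pow_zero, one_mul, Equiv.Perm.one_apply]
  | succ j ih =>
    have hstep := hσ.oddExt_vecMul (v := v) ((σ ^ j) x)
    rw [mem_negEigenspace_iff.1 hv, ih] at hstep
    rw [pow_succ', pow_succ', Equiv.Perm.mul_apply, neg_one_mul, neg_mul, ← hstep, oddExt,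
      oddExt, Pi.neg_apply, mul_neg, neg_neg]

theorem IsOrbitBlocks.apply_eq_zero_of_mem (h : IsOrbitBlocks σ a Rs) (hσ : IsSigned σ)
    (hv : v ∈ negEigenspace 𝕜 σ) (ha : v a = 0) {k : Fin n} (hk : k ∈ Rs.flatten) : v k = 0 := by
  obtain ⟨j, -, rfl⟩ := h.mem_flatten_iff.1 hk
  rw [← oddExt_eq_zero_iff, hσ.oddExt_pow_apply hv, oddExt_one, ha, mul_zero]

variable [NeZero (2 : 𝕜)]

theorem eq_zero_of_eq_neg {x : 𝕜} (h : x = -x) : x = 0 := by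
  rw [eq_neg_iff_add_eq_zero, ← two_mul] at h
  exact (mul_eq_zero.1 h).resolve_left two_ne_zero

theorem IsSigned.apply_ne_of_mem_negEigenspace (hσ : IsSigned σ) (hv : v ∈ negEigenspace 𝕜 σ)
    {k : Fin n} (hk : v k ≠ 0) : σ (1, k) ≠ (1, k) := fun hfix => by
  have hneg := hσ.oddExt_pow_apply hv 1 (1, k)
  rw [pow_one, pow_one, hfix, oddExt_one, neg_one_mul] at hneg
  exact hk (eq_zero_of_eq_neg hneg)

theorem IsOrbitBlocks.even_length_iff_of_mem_negEigenspace (h : IsOrbitBlocks σ a Rs)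
    (hσ : IsSigned σ) (hv : v ∈ negEigenspace 𝕜 σ) (ha : v a ≠ 0) :
    Even Rs.length ↔ Even (Rs.map List.length).sum := by
  have hne : (-1 : 𝕜) ≠ 1 := fun hone => one_ne_zero (eq_zero_of_eq_neg hone.symm)
  have hpow := hσ.oddExt_pow_apply hv (Rs.map List.length).sum (1, a)
  rw [h.pow_apply, oddExt_one, oddExt] at hpow
  push_cast at hpow
  rw [← neg_one_pow_eq_one_iff_even hne, mul_right_cancel₀ ha hpow,
    neg_one_pow_eq_one_iff_even hne]

theorem eq_zero_of_mem_negEigenspace (hσ : IsSigned σ) (he : IsExpanding σ)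
    {R : ↥(evenTypeB σ ∪ oddTypeC σ) → List (List (Fin n))} (hR : ∀ C, IsTypeBOrC σ (R C) C)
    {head : ↥(evenTypeB σ ∪ oddTypeC σ) → Fin n} (hhead : ∀ C, IsOrbitBlocks σ (head C) (R C))
    (hv : v ∈ negEigenspace 𝕜 σ) (hzero : ∀ C, v (head C) = 0) : v = 0 := by
  by_contra hne
  obtain ⟨k, hk⟩ := Function.ne_iff.1 hne
  obtain ⟨j, Rs, hblocks⟩ := exists_isOrbitBlocks hσ he (hσ.apply_ne_of_mem_negEigenspace hv hk)
  have ha : v ((σ ^ j) (1, k)).2 ≠ 0 := by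
    rw [Ne, ← oddExt_eq_zero_iff, hσ.oddExt_pow_apply hv, oddExt_one]
    exact mul_ne_zero (pow_ne_zero _ (neg_ne_zero.2 one_ne_zero)) hk
  obtain ⟨C, hC⟩ := hblocks.exists_isTypeBOrC hσ
  have hmem := (hC.mem_evenTypeB_union_oddTypeC_iff hσ).2
    (hblocks.even_length_iff_of_mem_negEigenspace hσ hv ha)
  have hflatten : ((σ ^ j) (1, k)).2 ∈ (R ⟨C, hmem⟩).flatten := by
    rw [← List.mem_toFinset, ← (hR ⟨C, hmem⟩).absSupport_eq, hC.absSupport_eq, List.mem_toFinset]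
    exact hblocks.mem_flatten
  exact ha ((hhead ⟨C, hmem⟩).apply_eq_zero_of_mem hσ hv (hzero _) hflatten)

variable (𝕜) in
theorem exists_basis_negEigenspace (hσ : IsSigned σ) (he : IsExpanding σ)
    (R : ↥(evenTypeB σ ∪ oddTypeC σ) → List (List (Fin n))) (hR : ∀ C, IsTypeBOrC σ (R C) C) :
    ∃ b : Module.Basis ↥(evenTypeB σ ∪ oddTypeC σ) 𝕜 (negEigenspace 𝕜 σ),
      ∀ C, (b C : Fin n → 𝕜) = cycleVector 𝕜 σ (R C) := by
  classical
  choose head hhead using fun C => (hR C).exists_isOrbitBlocks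
  have hparity (C) := ((hR C).mem_evenTypeB_union_oddTypeC_iff hσ).1 C.2
  have hdual : Module.DualBases
      (fun C => (⟨cycleVector 𝕜 σ (R C), (hhead C).cycleVector_mem_negEigenspace hσ (hparity C)⟩ :
        negEigenspace 𝕜 σ))
      (fun C => LinearMap.proj (head C) ∘ₗ (negEigenspace 𝕜 σ).subtype) := by
    refine ⟨fun C => (hhead C).cycleVector_apply_self 𝕜 hσ, fun C C' hne => ?_,
      fun {u₁ u₂} hu => ?_, fun _ => Set.toFinite _⟩
    · refine (hhead C').cycleVector_apply_of_notMem 𝕜 hσ fun hmem => hne (Subtype.ext ?_)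
      exact (hR C).eq_of_mem_flatten (hR C') (hhead C).mem_flatten hmem
    · refine sub_eq_zero.1 (Subtype.ext ?_)
      exact eq_zero_of_mem_negEigenspace hσ he hR hhead (u₁ - u₂).2
        fun C => sub_eq_zero.2 (hu C)
  exact ⟨hdual.basis, fun C => congrArg Subtype.val (congrFun hdual.coe_basis C)⟩

end SignedMatrix

section Pipes

variable {n : ℕ} (Δ : Finset (Box n))

theorem isBlack_comm {r c : ℕ} : IsBlack Δ r c ↔ IsBlack Δ c r := by
  simp only [IsBlack, or_comm]

theorem isBlack_iff_mem (b : Box n) : IsBlack Δ b.1 b.2 ↔ b ∈ Δ := by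
  refine ⟨?_, fun h => ⟨b, h, Or.inl ⟨rfl, rfl⟩⟩⟩
  obtain ⟨r, c⟩ := b
  rintro ⟨⟨r', c'⟩, hb, h⟩
  have hc := c.isLt
  have hc' := c'.isLt
  dsimp only at h hc hc'
  obtain rfl : r' = r := Fin.ext (by omega)
  obtain rfl : c' = c := Fin.ext (by omega)
  exact hb

theorem isBlack_univ {r c : ℕ} (hr : r < n) (hc : c < n) :
    IsBlack (Finset.univ : Finset (Box n)) r c := by
  rcases le_total c r with h | h
  · exact (isBlack_iff_mem _ ⟨⟨r, hr⟩, ⟨c, Nat.lt_succ_of_le h⟩⟩).2 (Finset.mem_univ _)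
  · exact (isBlack_comm _).1
      ((isBlack_iff_mem _ ⟨⟨c, hc⟩, ⟨r, Nat.lt_succ_of_le h⟩⟩).2 (Finset.mem_univ _))

theorem followPipe_up_eq (hn : 0 < n) (r c : ℕ) :
    followPipe hn Δ .up r c = signMul (-1) (followPipe hn Δ .left c r) := by
  induction hk : r + c using Nat.strong_induction_on generalizing r c with
  | h k ih =>
    rcases r with - | r
    · rw [followPipe, followPipe]
      rfl
    · rw [followPipe, followPipe]
      simp only [isBlack_comm Δ (r := c)]
      split_ifs
      · exact ih (r + c) (by omega) r c rfl
      · rw [ih (c + r) (by omega) c r rfl, signMul_signMul, neg_one_mul, neg_neg, signMul, one_mul]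

theorem isSigned_pipePerm : IsSigned (pipePerm Δ) := by
  intro e x
  have hneg (k : Fin n) : pipeEnd Δ (-1, k) = signMul (-1) (pipeEnd Δ (1, k)) := by
    have hne : (-1 : ℤˣ) ≠ 1 := by decide
    rw [pipeEnd, pipeEnd, if_neg hne, if_pos rfl, followPipe_up_eq]
  obtain ⟨e', k⟩ := x
  have hsign (e : ℤˣ) : pipeEnd Δ (e, k) = signMul e (pipeEnd Δ (1, k)) := by
    rcases Int.units_eq_one_or e with rfl | rfl
    · rw [signMul, one_mul]
    · exact hneg k
  change pipeEnd Δ (e * e', k) = signMul e (pipeEnd Δ (e', k))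
  rw [hsign, hsign e', signMul_signMul]

theorem le_followPipe (hn : 0 < n) (d : Heading) (r c : ℕ)
    (h : (followPipe hn Δ d r c).1 = 1) : n - 1 - r ≤ (followPipe hn Δ d r c).2 := by
  fun_induction followPipe hn Δ d r c with
  | case1 r => exact le_rfl
  | case2 r c _ ih => exact ih h
  | case3 r c _ ih => exact ih h
  | case4 c =>
    have hsign : (-1 : ℤˣ) = 1 := h
    exact absurd hsign (by decide)
  | case5 r c _ ih => exact (by omega : _ ≤ _).trans (ih h)
  | case6 r c _ ih => exact (by omega : _ ≤ _).trans (ih h)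

theorem isExpanding_pipePerm : IsExpanding (pipePerm Δ) := by
  rintro ⟨e, k⟩ h
  rw [(isSigned_pipePerm Δ).apply_mk] at h ⊢
  have hk := le_followPipe Δ (Fin.pos k) .left (n - 1 - k) n (mul_eq_left.1 h)
  have hle : (k : ℕ) ≤ n - 1 - (n - 1 - k) := by omega
  exact Fin.le_def.2 (hle.trans hk)

theorem pipePerm_univ : pipePerm (Finset.univ : Finset (Box n)) = 1 := by
  have hstraight (hn : 0 < n) {r : ℕ} (hr : r < n) (c : ℕ) (hc : c ≤ n) :
      followPipe hn Finset.univ .left r c = (1, ⟨n - 1 - r, by omega⟩) := by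
    induction c with
    | zero => rw [followPipe, exitLabel]
    | succ c ih => rw [followPipe, if_pos (isBlack_univ hr hc), ih (by omega)]
  ext1 ⟨e, k⟩
  rw [(isSigned_pipePerm _).apply_mk]
  change signMul e (followPipe (Fin.pos k) _ .left (n - 1 - k) n) = (e, k)
  rw [hstraight _ (by omega) _ le_rfl, signMul, mul_one]
  exact Prod.ext rfl (Fin.ext (by simp only; omega))

end Pipes

section Reflections

variable (𝕜 : Type*) [Field 𝕜] {n : ℕ}

/-- The basis vector with the index `m`, counted from `0`, and `0` if `m` is out of range. -/
def stdVec (n m : ℕ) : Fin n → 𝕜 :=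
  fun k => if (k : ℕ) = m then 1 else 0

theorem signedVec_one_eq_stdVec (k : Fin n) : signedVec 𝕜 (1, k) = stdVec 𝕜 n k := by
  ext j
  simp [signedVec, stdVec, Pi.single_apply, Fin.ext_iff]

theorem simpleReflection_stdVec_of_ne {i : Fin n} {m : ℕ} (hi : m ≠ i) (hi' : m ≠ i + 1) :
    simpleReflection 𝕜 i (stdVec 𝕜 n m) = stdVec 𝕜 n m := by
  have hcoroot : simpleCoroot 𝕜 i (stdVec 𝕜 n m) = 0 := by
    unfold simpleCoroot
    split_ifs <;> simp [stdVec, hi.symm, hi'.symm]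
  rw [simpleReflection, Module.reflection_apply, hcoroot, zero_smul, sub_zero]

theorem simpleReflection_stdVec_self {i : Fin n} (hi : (i : ℕ) + 1 < n) :
    simpleReflection 𝕜 i (stdVec 𝕜 n i) = stdVec 𝕜 n (i + 1) := by
  have hcoroot : simpleCoroot 𝕜 i (stdVec 𝕜 n i) = 1 := by
    simp [simpleCoroot, hi, stdVec]
  have hroot : simpleRoot 𝕜 i = stdVec 𝕜 n i - stdVec 𝕜 n (i + 1) := by
    ext j
    simp [simpleRoot, hi, stdVec, Pi.single_apply, Fin.ext_iff]
  rw [simpleReflection, Module.reflection_apply, hcoroot, one_smul, hroot, sub_sub_cancel]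

theorem simpleReflection_stdVec_succ {i : Fin n} (hi : (i : ℕ) + 1 < n) :
    simpleReflection 𝕜 i (stdVec 𝕜 n (i + 1)) = stdVec 𝕜 n i := by
  rw [← simpleReflection_stdVec_self 𝕜 hi]
  exact Module.involutive_reflection (simpleCoroot_simpleRoot 𝕜 i) _

theorem simpleReflection_stdVec_last {i : Fin n} (hi : (i : ℕ) + 1 = n) :
    simpleReflection 𝕜 i (stdVec 𝕜 n i) = -stdVec 𝕜 n i := by
  have hcoroot : simpleCoroot 𝕜 i (stdVec 𝕜 n i) = 2 := by
    simp [simpleCoroot, hi, stdVec]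
  have hroot : simpleRoot 𝕜 i = stdVec 𝕜 n i := by
    ext j
    simp [simpleRoot, hi, stdVec, Pi.single_apply, Fin.ext_iff]
  rw [simpleReflection, Module.reflection_apply, hcoroot, hroot, two_smul, sub_add_cancel_left]

variable (Δ : Finset (Box n))

/-- The factor of `w^Δ` in the square `(r, c)`: the reflection of the square if it is black, and
the identity otherwise. It agrees with `subReflection` on the boxes; the bound in the condition only
makes it total in `r` and `c`. -/
noncomputable def squareElt (r c : ℕ) : (Fin n → 𝕜) ≃ₗ[𝕜] (Fin n → 𝕜) :=
  if h : n - 1 - r + c < n ∧ IsBlack Δ r c then simpleReflection 𝕜 ⟨_, h.1⟩ else 1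

/-- The initial part of the product `w^Δ` that consists of the factors before the square `(r, c)` in
reading order. -/
noncomputable def initialElt (r c : ℕ) : (Fin n → 𝕜) ≃ₗ[𝕜] (Fin n → 𝕜) :=
  ((List.range r).map fun i => ((List.range (i + 1)).map (squareElt 𝕜 Δ i)).prod).prod *
    ((List.range c).map (squareElt 𝕜 Δ r)).prod

theorem initialElt_succ_zero (r : ℕ) : initialElt 𝕜 Δ (r + 1) 0 = initialElt 𝕜 Δ r (r + 1) := by
  simp [initialElt, List.range_succ (n := r)]

theorem initialElt_succ (r c : ℕ) :
    initialElt 𝕜 Δ r (c + 1) = initialElt 𝕜 Δ r c * squareElt 𝕜 Δ r c := by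
  simp [initialElt, List.range_succ (n := c), mul_assoc]

theorem subReflection_eq_squareElt (b : Box n) :
    subReflection 𝕜 Δ b = squareElt 𝕜 Δ b.1 b.2 := by
  by_cases hb : b ∈ Δ
  · rw [subReflection, if_pos hb, squareElt,
      dif_pos ⟨(boxIndex b).isLt, (isBlack_iff_mem Δ b).2 hb⟩]
    rfl
  · rw [subReflection, if_neg hb, squareElt, dif_neg fun h => hb ((isBlack_iff_mem Δ b).1 h.2)]

theorem subElt_eq_initialElt : subElt 𝕜 Δ = initialElt 𝕜 Δ n 0 := by
  rw [subElt, boxes, List.map_flatMap, List.flatMap_def, List.prod_flatten, initialElt,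
    List.range_zero, List.map_nil, List.prod_nil, mul_one, ← List.map_coe_finRange_eq_range,
    List.map_map, List.map_map]
  congr 1
  refine List.map_congr_left fun r _ => ?_
  simp only [Function.comp_apply, ← List.map_coe_finRange_eq_range, List.map_map]
  congr 1
  exact List.map_congr_left fun c _ => subReflection_eq_squareElt 𝕜 Δ ⟨r, c⟩

variable {Δ}

theorem squareElt_of_not_isBlack {r c : ℕ} (hb : ¬IsBlack Δ r c) : squareElt 𝕜 Δ r c = 1 :=
  dif_neg fun h => hb h.2

theorem squareElt_of_isBlack {r c : ℕ} (hb : IsBlack Δ r c) (hlt : n - 1 - r + c < n) :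
    squareElt 𝕜 Δ r c = simpleReflection 𝕜 ⟨n - 1 - r + c, hlt⟩ :=
  dif_pos ⟨hlt, hb⟩

variable (Δ)

theorem squareElt_stdVec_of_ne {r c m : ℕ} (h : m ≠ n - 1 - r + c) (h' : m ≠ n - 1 - r + c + 1) :
    squareElt 𝕜 Δ r c (stdVec 𝕜 n m) = stdVec 𝕜 n m := by
  unfold squareElt
  split_ifs
  · exact simpleReflection_stdVec_of_ne 𝕜 h h'
  · rfl

theorem initialElt_stdVec_of_le {r c d m : ℕ} (hcd : c ≤ d)
    (hm : m < n - 1 - r + c ∨ n - 1 - r + d < m) :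
    initialElt 𝕜 Δ r d (stdVec 𝕜 n m) = initialElt 𝕜 Δ r c (stdVec 𝕜 n m) := by
  induction d, hcd using Nat.le_induction with
  | base => rfl
  | succ d hd ih =>
    rw [initialElt_succ, LinearEquiv.mul_apply, squareElt_stdVec_of_ne _ _ (by omega) (by omega),
      ih (by omega)]

theorem initialElt_zero_stdVec {r m : ℕ} (h : m + r < n) :
    initialElt 𝕜 Δ r 0 (stdVec 𝕜 n m) = stdVec 𝕜 n m := by
  induction r with
  | zero => rfl
  | succ r ih =>
    rw [initialElt_succ_zero, initialElt_stdVec_of_le 𝕜 Δ (Nat.zero_le _) (by omega),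
      ih (by omega)]

theorem initialElt_succ_zero_stdVec {r c : ℕ} (hc : c ≤ r) :
    initialElt 𝕜 Δ (r + 1) 0 (stdVec 𝕜 n (n - 1 - r + c)) =
      initialElt 𝕜 Δ r c (squareElt 𝕜 Δ r c (stdVec 𝕜 n (n - 1 - r + c))) := by
  rw [initialElt_succ_zero, initialElt_stdVec_of_le 𝕜 Δ (Nat.succ_le_succ hc) (by omega),
    initialElt_succ, LinearEquiv.mul_apply]

-- Splitting off the last factor of an initial part of `w^Δ` moves a pipe by one square.
mutual

theorem initialElt_stdVec_left (hn : 0 < n) :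
    ∀ r c : ℕ, c ≤ r → r < n →
      initialElt 𝕜 Δ r c (stdVec 𝕜 n (n - 1 - r + c)) = signedVec 𝕜 (followPipe hn Δ .left r c)
  | r, 0, _, hr => by
    rw [followPipe, exitLabel, signedVec_one_eq_stdVec]
    exact initialElt_zero_stdVec _ _ (by omega)
  | r, c + 1, hc, hr => by
    rw [followPipe, initialElt_succ, LinearEquiv.mul_apply]
    split_ifs with hb
    · rw [squareElt_of_isBlack 𝕜 hb (by omega), ← add_assoc]
      exact (congrArg _ (simpleReflection_stdVec_succ 𝕜 (by simp only; omega))).trans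
        (initialElt_stdVec_left hn r c (by omega) hr)
    · rw [squareElt_of_not_isBlack 𝕜 hb, LinearEquiv.coe_one, id_eq,
        initialElt_stdVec_of_le 𝕜 Δ (Nat.zero_le c) (by omega),
        show n - 1 - r + (c + 1) = n - r + c by omega]
      exact initialElt_stdVec_up hn r c (by omega) hr.le
termination_by r c => r + c

theorem initialElt_stdVec_up (hn : 0 < n) :
    ∀ r c : ℕ, c < r → r ≤ n →
      initialElt 𝕜 Δ r 0 (stdVec 𝕜 n (n - r + c)) = signedVec 𝕜 (followPipe hn Δ .up r c)
  | r + 1, c, hc, hr => by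
    rw [followPipe, show n - (r + 1) + c = n - 1 - r + c by omega,
      initialElt_succ_zero_stdVec 𝕜 Δ (by omega)]
    split_ifs with hb
    · rw [squareElt_of_isBlack 𝕜 hb (by omega)]
      obtain hlt | heq := (Nat.lt_succ_iff.1 hc).lt_or_eq
      · refine (congrArg _ (simpleReflection_stdVec_self 𝕜 (by simp only; omega))).trans ?_
        rw [initialElt_stdVec_of_le 𝕜 Δ (Nat.zero_le c) (by simp only; omega),
          ← initialElt_stdVec_up hn r c hlt (by omega)]
        congr 2
        simp only
        omega
      · refine (congrArg _ (simpleReflection_stdVec_last 𝕜 (by simp only; omega))).trans ?_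
        rw [map_neg, initialElt_stdVec_left hn r c heq.le (by omega), followPipe_up_eq,
          signedVec_signMul, heq]
        simp
    · rw [squareElt_of_not_isBlack 𝕜 hb, LinearEquiv.coe_one, id_eq]
      exact initialElt_stdVec_left hn r c (by omega) (by omega)
termination_by r c => r + c

end

theorem subElt_signedVec (x : SignedIndex n) :
    subElt 𝕜 Δ (signedVec 𝕜 (-x.1, x.2.rev)) = signedVec 𝕜 (pipePerm Δ x) := by
  obtain ⟨e, k⟩ := x
  have hneg : subElt 𝕜 Δ (signedVec 𝕜 (1, k.rev)) = signedVec 𝕜 (pipePerm Δ (-1, k)) := by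
    rw [signedVec_one_eq_stdVec, subElt_eq_initialElt]
    refine Eq.trans ?_ (initialElt_stdVec_up 𝕜 Δ (Fin.pos k) n (n - 1 - k) (by omega) le_rfl)
    congr 2
    rw [Fin.val_rev]
    omega
  have hx : (-e, k.rev) = signMul (-e) (1, k.rev) := by rw [signMul, mul_one]
  have hx' : signMul (-e) (-1, k) = (e, k) := by rw [signMul, neg_mul_neg, mul_one]
  rw [hx, signedVec_signMul, map_smul, hneg, ← signedVec_signMul, ← isSigned_pipePerm, hx']

theorem maxElt_eq_subElt : maxElt 𝕜 n = subElt 𝕜 Finset.univ := by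
  have h : subReflection 𝕜 (Finset.univ : Finset (Box n)) =
      fun b => simpleReflection 𝕜 (boxIndex b) :=
    funext fun b => if_pos (Finset.mem_univ b)
  rw [maxElt, subElt, h]

theorem subElt_maxElt_symm (v : Fin n → 𝕜) :
    subElt 𝕜 Δ ((maxElt 𝕜 n).symm v) = Matrix.vecMul v (signedMatrix 𝕜 (pipePerm Δ)) := by
  have hbasis (k : Fin n) : subElt 𝕜 Δ ((maxElt 𝕜 n).symm (signedVec 𝕜 (1, k))) =
      Matrix.vecMul (signedVec 𝕜 (1, k)) (signedMatrix 𝕜 (pipePerm Δ)) := by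
    have hmax := subElt_signedVec 𝕜 Finset.univ (1, k)
    rw [← maxElt_eq_subElt, pipePerm_univ, Equiv.Perm.one_apply] at hmax
    rw [(isSigned_pipePerm Δ).signedVec_vecMul 𝕜, (maxElt 𝕜 n).symm_apply_eq.2 hmax.symm,
      subElt_signedVec]
  have hmaps : (subElt 𝕜 Δ).toLinearMap ∘ₗ (maxElt 𝕜 n).symm.toLinearMap =
      (signedMatrix 𝕜 (pipePerm Δ)).vecMulLinear :=
    (Pi.basisFun 𝕜 (Fin n)).ext fun k => by
      simpa [signedVec] using hbasis k
  exact LinearMap.congr_fun hmaps v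

theorem kernel_eq_comap_negEigenspace :
    kernel 𝕜 Δ = (negEigenspace 𝕜 (pipePerm Δ)).comap (maxElt 𝕜 n).toLinearMap := by
  ext u
  rw [Submodule.mem_comap, mem_negEigenspace_iff, LinearEquiv.coe_coe, ← subElt_maxElt_symm,
    LinearEquiv.symm_apply_apply, eq_neg_iff_add_eq_zero]
  rfl

theorem exists_basis_kernel [NeZero (2 : 𝕜)]
    (R : ↥(evenTypeB (pipePerm Δ) ∪ oddTypeC (pipePerm Δ)) → List (List (Fin n)))
    (hR : ∀ C, IsTypeBOrC (pipePerm Δ) (R C) C) :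
    ∃ b : Module.Basis ↥(evenTypeB (pipePerm Δ) ∪ oddTypeC (pipePerm Δ)) 𝕜 (kernel 𝕜 Δ),
      ∀ C, maxElt 𝕜 n (b C : Fin n → 𝕜) = cycleVector 𝕜 (pipePerm Δ) (R C) := by
  obtain ⟨b, hb⟩ :=
    exists_basis_negEigenspace 𝕜 (isSigned_pipePerm Δ) (isExpanding_pipePerm Δ) R hR
  let φ : kernel 𝕜 Δ ≃ₗ[𝕜] negEigenspace 𝕜 (pipePerm Δ) :=
    (LinearEquiv.ofEq _ _ (kernel_eq_comap_negEigenspace 𝕜 Δ)).trans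
      ((maxElt 𝕜 n).ofSubmodule' _)
  refine ⟨b.map φ.symm, fun C => ?_⟩
  rw [← hb, Module.Basis.map_apply]
  exact congrArg Subtype.val (φ.apply_symm_apply (b C))

end Reflections

theorem exists_isTypeBOrC_of_mem {n : ℕ} {σ : Equiv.Perm (SignedIndex n)}
    {C : Finset (Equiv.Perm (SignedIndex n))} (hC : C ∈ evenTypeB σ ∪ oddTypeC σ) :
    ∃ Rs, IsTypeBOrC σ Rs C := by
  obtain ⟨Rs, hb, -⟩ | ⟨Rs, hc, -⟩ := hC
  · exact ⟨Rs, Or.inl hb⟩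
  · exact ⟨Rs, Or.inr hc⟩

end TypeB

theorem mainTheorem4_general (𝕜 : Type*) [Field 𝕜] [NeZero (2 : 𝕜)] (n : ℕ)
    (Δ : Finset (TypeB.Box n)) :
    Module.finrank 𝕜 (TypeB.kernel 𝕜 Δ) =
        (TypeB.evenTypeB (TypeB.pipePerm Δ)).ncard + (TypeB.oddTypeC (TypeB.pipePerm Δ)).ncard ∧
      ∀ R : ↥(TypeB.evenTypeB (TypeB.pipePerm Δ) ∪ TypeB.oddTypeC (TypeB.pipePerm Δ)) →
          List (List (Fin n)),
        (∀ C, TypeB.IsTypeB (TypeB.pipePerm Δ) (R C) C ∨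
          TypeB.IsTypeC (TypeB.pipePerm Δ) (R C) C) →
        ∃ b : Module.Basis
            ↥(TypeB.evenTypeB (TypeB.pipePerm Δ) ∪ TypeB.oddTypeC (TypeB.pipePerm Δ)) 𝕜
            (TypeB.kernel 𝕜 Δ),
          ∀ C, TypeB.maxElt 𝕜 n (b C : Fin n → 𝕜) =
            TypeB.cycleVector 𝕜 (TypeB.pipePerm Δ) (R C) := by
  refine ⟨?_, TypeB.exists_basis_kernel 𝕜 Δ⟩
  choose R hR using fun C : ↥(TypeB.evenTypeB (TypeB.pipePerm Δ) ∪
    TypeB.oddTypeC (TypeB.pipePerm Δ)) => TypeB.exists_isTypeBOrC_of_mem C.2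
  obtain ⟨b, -⟩ := TypeB.exists_basis_kernel 𝕜 Δ R hR
  rw [Module.finrank_eq_nat_card_basis b, Nat.card_coe_set_eq,
    Set.ncard_union_eq TypeB.disjoint_evenTypeB_oddTypeC]

theorem mainTheorem4 (𝕜 : Type*) [Field 𝕜] [CharZero 𝕜] (n : ℕ) (Δ : Finset (TypeB.Box n))
    (hΔ : TypeB.IsCauchon 𝕜 Δ) :
    Module.finrank 𝕜 (TypeB.kernel 𝕜 Δ) =
        (TypeB.evenTypeB (TypeB.pipePerm Δ)).ncard + (TypeB.oddTypeC (TypeB.pipePerm Δ)).ncard ∧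
      ∀ R : ↥(TypeB.evenTypeB (TypeB.pipePerm Δ) ∪ TypeB.oddTypeC (TypeB.pipePerm Δ)) →
          List (List (Fin n)),
        (∀ C, TypeB.IsTypeB (TypeB.pipePerm Δ) (R C) C ∨
          TypeB.IsTypeC (TypeB.pipePerm Δ) (R C) C) →
        ∃ b : Module.Basis
            ↥(TypeB.evenTypeB (TypeB.pipePerm Δ) ∪ TypeB.oddTypeC (TypeB.pipePerm Δ)) 𝕜
            (TypeB.kernel 𝕜 Δ),
          ∀ C, TypeB.maxElt 𝕜 n (b C : Fin n → 𝕜) =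
            TypeB.cycleVector 𝕜 (TypeB.pipePerm Δ) (R C) :=
  mainTheorem4_general 𝕜 n Δ
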